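/- Let $G$ be a finite group and let $d$ be a local dimension. For a tensor $M=(M^i)_i$ of square matrices, call $M$ injective if the linear map $X\mapsto \big(\sum_{a,b}M^i_{ab}X_{ab}\big)_i$ has a left inverse. Say that a pair $(\widehat P,P)$ reduces $M$ to $N$ if for all $m\ge 0$ $$\widehat P\,M^{i_1}\cdots M^{i_m}\,P=N^{i_1}\cdots N^{i_m},\qquad M^{i}M^{i_0}\cdots M^{i_m}M^{j}=M^{i}\,P\,N^{i_0}\cdots N^{i_m}\,\widehat P\,M^{j}.$$ Setting. (i) For each $g\in G$ let $T_g=(T_g^{ij})_{i,j\le d}$ be an injective tensor such that for all $N\ge 1$ the operators $U_g=\sum \mathrm{Tr}[T_g^{i_1j_1}\cdots T_g^{i_Nj_N}]\,|i_1\dots i_N\rangle\langle j_1\dots j_N|$ are unitary, $U_gU_h=U_{gh}$ and $U_e=\mathbb 1$. (ii) Let $G$ act transitively on a set $\mathcal I$, and for $x\in\mathcal I$ let $A_x=(A_x^i)_{i\le d}$ be an injective tensor of bond dimension $\geq 1$ such that the states $|\psi_x\rangle=\sum\mathrm{Tr}[A_x^{i_1}\cdots A_x^{i_N}]|i_1\dots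 i_N\rangle$ satisfy $U_g|\psi_x\rangle=|\psi_{gx}\rangle$ for all $N\ge1$. (iii) Write $(T_gT_h)^{ik}=\sum_j T_g^{ij}\otimes T_h^{jk}$ and $(T_gM)^i=\sum_jT_g^{ij}\otimes M^j$. Let $(\widehat V_{g,h},V_{g,h})$ be any fusion tensors, i.e. pairs reducing $T_gT_h$ to $T_{gh}$, and let $(\widehat W_{g,x},W_{g,x})$ be any action tensors, i.e. pairs reducing $T_gA_x$ to $A_{gx}$. (iv) Let $e_{xy}=(e^i_{xy})_{i\le d}$ ($x,y\in\mathcal I$) be nonzero domain-wall tensors such that the states $|\psi(x,y)\rangle=\sum\mathrm{Tr}[e_{xy}^{i_1}A_y^{i_2}\cdots A_y^{i_{l-1}}e_{yx}^{i_l}A_x^{i_{l+1}}\cdots A_x^{i_N}]|i_1\dots i_N\rangle$ satisfy $U_g|\psi(x,y)\rangle\propto|\psi(gx,gy)\rangle$ for all $g,x,y$ whenever the two walls are sufficiently far apart (both $l$ and $N-l$ large). Then there are unique numbers $L^x_{g,h}\in\mathbb C$ (the $L$-symbols) such that for all physical indices $i,j,k$, with $C=T_gT_hA_x$, $$C^iC^jC^k\,(V_{g,h}\otimes\mathbb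 1)\,W_{gh,x}=L^x_{g,h}\;C^iC^jC^k\,(\mathbb 1\otimes W_{h,x})\,W_{g,hx},$$ and unique numbers $B^g_{x,y}\in\mathbb C$ such that for all $i,j,k$ $$\widehat W_{g,x}\,(T_gA_x)^i(T_ge_{xy})^j(T_gA_y)^k\,W_{g,y}=B^g_{x,y}\;A_{gx}^i\,e_{gx,gy}^j\,A_{gy}^k .$$ All these numbers are nonzero (they are defined up to rescaling of the chosen tensors, and are phases in the customary normalisation), and $$B^{g}_{hx,hy}\,B^{h}_{x,y}=\frac{L^{x}_{g,h}}{L^{y}_{g,h}}\,B^{gh}_{x,y}\qquad\text{for all } g,h\in G,\ x,y\in\mathcal I .$$ -/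

import Mathlib

open scoped Kronecker

namespace DomainWalls

/-- A translation-invariant tensor with physical index `ι` and virtual index `n`:
one `n × n` matrix for each physical index. -/
abbrev Tensor (ι n : Type*) := ι → Matrix n n ℂ

/-- A tensor read as a linear map from the virtual to the physical space. -/
def toPhysical {ι n : Type*} [Fintype n] (A : Tensor ι n) : Matrix n n ℂ →ₗ[ℂ] (ι → ℂ) where
  toFun X i := ∑ a, ∑ b, A i a b * X a b
  map_add' X Y := by
    funext i
    simp [mul_add, Finset.sum_add_distrib]
  map_smul' c X := by
    funext i
    simp [Finset.mul_sum, mul_left_comm]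

/-- A tensor is injective if, as a map from virtual to physical space, it has a left inverse. -/
def IsInjective {ι n : Type*} [Fintype n] (A : Tensor ι n) : Prop :=
  ∃ Ainv : (ι → ℂ) →ₗ[ℂ] Matrix n n ℂ, Ainv ∘ₗ toPhysical A = LinearMap.id

/-- The product `A^{i₁} ⋯ A^{iₘ}` along consecutive sites (the identity for `m = 0`). -/
def word {ι n : Type*} [Fintype n] [DecidableEq n] (A : Tensor ι n) (w : List ι) :
    Matrix n n ℂ :=
  (w.map A).prod

/-- The periodic matrix product state `∑ Tr[A^{i₁} ⋯ A^{i_N}] |i₁ … i_N⟩`, by its coefficients. -/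
def mps {d D : ℕ} (A : Tensor (Fin d) (Fin D)) (N : ℕ) : (Fin N → Fin d) → ℂ :=
  fun i => (word A (List.ofFn i)).trace

/-- The periodic matrix product operator
`∑ Tr[T^{i₁ j₁} ⋯ T^{i_N j_N}] |i₁ … i_N⟩⟨j₁ … j_N|`, as a matrix. -/
def mpo {d χ : ℕ} (T : Tensor (Fin d × Fin d) (Fin χ)) (N : ℕ) :
    Matrix (Fin N → Fin d) (Fin N → Fin d) ℂ :=
  Matrix.of fun i j => (word T (List.ofFn fun k => (i k, j k))).trace

/-- One site of an operator tensor on top of one site of a state tensor (the latter may have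
different left and right virtual spaces, as domain-wall tensors do). -/
def applyMPO {ι c a b : Type*} [Fintype ι] (T : Tensor (ι × ι) c) (M : ι → Matrix a b ℂ) :
    ι → Matrix (c × a) (c × b) ℂ :=
  fun i => ∑ j, T (i, j) ⊗ₖ M j

/-- One site of an operator tensor on top of one site of another operator tensor. -/
def stackMPO {ι c a : Type*} [Fintype ι] (T : Tensor (ι × ι) c) (S : Tensor (ι × ι) a) :
    Tensor (ι × ι) (c × a) :=
  fun ik => ∑ j, T (ik.1, j) ⊗ₖ S (j, ik.2)

/-- `(P, Q)` locally reduces the tensor `B` to the tensor `A`: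
`P B^{i₁} ⋯ B^{iₘ} Q = A^{i₁} ⋯ A^{iₘ}` for all `m ≥ 0` and
`B^i B^{i₀} ⋯ B^{iₘ} B^j = B^i Q A^{i₀} ⋯ A^{iₘ} P B^j` for all `m ≥ 0`. -/
structure IsReduction {ι n k : Type*} [Fintype n] [DecidableEq n] [Fintype k] [DecidableEq k]
    (B : Tensor ι n) (A : Tensor ι k) (P : Matrix k n ℂ) (Q : Matrix n k ℂ) : Prop where
  reduce : ∀ w : List ι, P * word B w * Q = word A w
  insert : ∀ (i j : ι) (w : List ι), w ≠ [] →
    B i * word B w * B j = B i * Q * word A w * P * B j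

/-- A representation of `G` by matrix product unitaries with injective tensors, on periodic
chains of every length `N ≥ 1` with local dimension `d`. -/
structure MPURep (G : Type*) [Group G] (d : ℕ) where
  /-- bond dimensions -/
  χ : G → ℕ
  T : ∀ g, Tensor (Fin d × Fin d) (Fin (χ g))
  injective : ∀ g, IsInjective (T g)
  unitary : ∀ (N : ℕ), 0 < N → ∀ g, mpo (T g) N ∈ Matrix.unitaryGroup (Fin N → Fin d) ℂ
  map_one : ∀ (N : ℕ), 0 < N → mpo (T 1) N = 1
  map_mul : ∀ (N : ℕ), 0 < N → ∀ g h, mpo (T g) N * mpo (T h) N = mpo (T (g * h)) N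

/-- A family of injective matrix product states indexed by a `G`-set `I` and permuted
accordingly by the unitaries: `U_g |ψ_x⟩ = |ψ_{gx}⟩`. -/
structure GroundStates {G : Type*} [Group G] {d : ℕ} (R : MPURep G d)
    (I : Type*) [MulAction G I] where
  /-- bond dimensions -/
  D : I → ℕ
  D_pos : ∀ x, 0 < D x
  A : ∀ x, Tensor (Fin d) (Fin (D x))
  injective : ∀ x, IsInjective (A x)
  permute : ∀ (N : ℕ), 0 < N → ∀ (g : G) (x : I),
    (mpo (R.T g) N).mulVec (mps (A x) N) = mps (A (g • x)) N

/-- A choice of fusion tensors `(V_{g,h}, V̂_{g,h})`. -/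
structure FusionTensors {G : Type*} [Group G] {d : ℕ} (R : MPURep G d) where
  V : ∀ g h, Matrix (Fin (R.χ g) × Fin (R.χ h)) (Fin (R.χ (g * h))) ℂ
  Vhat : ∀ g h, Matrix (Fin (R.χ (g * h))) (Fin (R.χ g) × Fin (R.χ h)) ℂ
  isReduction : ∀ g h,
    IsReduction (stackMPO (R.T g) (R.T h)) (R.T (g * h)) (Vhat g h) (V g h)

/-- A choice of action tensors `(W_{g,x}, Ŵ_{g,x})`. They carry the label `y = gx` of the resulting
state (with a proof of `g • x = y`) only so that `(g * h) • x` and `g • h • x` need not be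
identified by casts. -/
structure ActionTensors {G : Type*} [Group G] {d : ℕ} {R : MPURep G d}
    {I : Type*} [MulAction G I] (S : GroundStates R I) where
  W : ∀ (g : G) {x y : I}, g • x = y → Matrix (Fin (R.χ g) × Fin (S.D x)) (Fin (S.D y)) ℂ
  What : ∀ (g : G) {x y : I}, g • x = y → Matrix (Fin (S.D y)) (Fin (R.χ g) × Fin (S.D x)) ℂ
  isReduction : ∀ (g : G) {x y : I} (hy : g • x = y),
    IsReduction (applyMPO (R.T g) (S.A x)) (S.A y) (What g hy) (W g hy)

/-- The state on `p + q + 2` sites with a pair of domain walls,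
`∑ Tr[e_{xy}^{i₁} A_y ⋯ A_y e_{yx}^{i_l} A_x ⋯ A_x] |i₁ … i_N⟩`, with `p` sites in the region `y`
and `q` sites in the region `x` (so `l = p + 2`, `N = p + q + 2`). -/
def wallState {d : ℕ} {I : Type*} {D : I → ℕ} (A : ∀ x, Tensor (Fin d) (Fin (D x)))
    (e : ∀ x y, Fin d → Matrix (Fin (D x)) (Fin (D y)) ℂ) (x y : I) (p q : ℕ) :
    (Fin (p + q + 2) → Fin d) → ℂ :=
  fun i =>
    (e x y (i ⟨0, by omega⟩)
      * word (A y) (List.ofFn fun k : Fin p => i ⟨k + 1, by omega⟩)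
      * e y x (i ⟨p + 1, by omega⟩)
      * word (A x) (List.ofFn fun k : Fin q => i ⟨p + 2 + k, by omega⟩)).trace

/-- Nonzero domain-wall tensors `e_{xy}` such that `U_g |ψ(x,y)⟩ ∝ |ψ(gx,gy)⟩`
whenever the two walls are sufficiently far apart on the ring. -/
structure WallTensors {G : Type*} [Group G] {d : ℕ} {R : MPURep G d}
    {I : Type*} [MulAction G I] (S : GroundStates R I) where
  e : ∀ x y, Fin d → Matrix (Fin (S.D x)) (Fin (S.D y)) ℂ
  ne_zero : ∀ x y, e x y ≠ 0
  permute : ∃ n₀ : ℕ, ∀ p q : ℕ, n₀ ≤ p → n₀ ≤ q → ∀ (g : G) (x y : I), ∃ c : ℂ,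
    (mpo (R.T g) (p + q + 2)).mulVec (wallState S.A e x y p q)
      = c • wallState S.A e (g • x) (g • y) p q

section Symbols

variable {G : Type*} [Group G] {d : ℕ} {R : MPURep G d}
  {I : Type*} [MulAction G I] {S : GroundStates R I}

/-- The right endpoint that first fuses `g` and `h` and then lets `gh` act on `x`. -/
def fuseThenAct (F : FusionTensors R) (K : ActionTensors S) (g h : G) (x : I) :
    Matrix (Fin (R.χ g) × (Fin (R.χ h) × Fin (S.D x))) (Fin (S.D (g • h • x))) ℂ :=
  (F.V g h ⊗ₖ (1 : Matrix (Fin (S.D x)) (Fin (S.D x)) ℂ)).submatrix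
      (Equiv.prodAssoc (Fin (R.χ g)) (Fin (R.χ h)) (Fin (S.D x))).symm id
    * K.W (g * h) (mul_smul g h x)

/-- The right endpoint that first lets `h` act on `x` and then `g` act on `hx`. -/
def actThenAct (K : ActionTensors S) (g h : G) (x : I) :
    Matrix (Fin (R.χ g) × (Fin (R.χ h) × Fin (S.D x))) (Fin (S.D (g • h • x))) ℂ :=
  ((1 : Matrix (Fin (R.χ g)) (Fin (R.χ g)) ℂ) ⊗ₖ K.W h (rfl : h • x = h • x))
    * K.W g (rfl : g • h • x = g • h • x)

/-- `L g h x` is the `L`-symbol `L^x_{g,h}`: on three sites of `T_g T_h A_x`, the endpoint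
"fuse, then act" equals `L^x_{g,h}` times the endpoint "act twice". -/
def IsLSymbol (F : FusionTensors R) (K : ActionTensors S) (L : G → G → I → ℂ) : Prop :=
  ∀ (g h : G) (x : I) (i j k : Fin d),
    word (applyMPO (R.T g) (applyMPO (R.T h) (S.A x))) [i, j, k] * fuseThenAct F K g h x
      = L g h x •
        (word (applyMPO (R.T g) (applyMPO (R.T h) (S.A x))) [i, j, k] * actThenAct K g h x)

/-- `B g x y` is the factor `B^g_{x,y}` by which `U_g` locally permutes domain walls:
`Ŵ_{g,x} (T_g A_x)^i (T_g e_{xy})^j (T_g A_y)^k W_{g,y}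
  = B^g_{x,y} A_{gx}^i e_{gx,gy}^j A_{gy}^k`. -/
def IsWallFactor (K : ActionTensors S) (E : WallTensors S) (B : G → I → I → ℂ) : Prop :=
  ∀ (g : G) (x y : I) (i j k : Fin d),
    K.What g (rfl : g • x = g • x)
        * applyMPO (R.T g) (S.A x) i * applyMPO (R.T g) (E.e x y) j * applyMPO (R.T g) (S.A y) k
        * K.W g (rfl : g • y = g • y)
      = B g x y • (S.A (g • x) i * E.e (g • x) (g • y) j * S.A (g • y) k)

end Symbols

end DomainWalls

/-! Injectivity of a tensor means that its matrices span the full matrix algebra. An identity linear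
in `A i` therefore holds with any matrix in place of `A i`, neighbouring sites cancel, and whatever
commutes with every `A i` is scalar.

For the L-symbols, both ways of reducing T_g T_h A_x to A_{ghx} are composites of two reductions. A
reduction to an injective tensor is essentially unique: once two sites shield the endpoints, any two
choices differ by a scalar r on the right and a scalar s on the left
(`IsDeepReduction.exists_smul`). Here s r = 1, because each matching pair of endpoints reduces a
long chain to the same nonzero word. Thus r is L and s is its inverse.

For the wall factors, inserting the action tensors in both arcs of U_g|ψ(x,y)⟩ turns it into a ring
of A_{gx}, A_{gy} with two dressed walls. Comparison with |ψ(gx,gy)⟩ and injectivity of the arcs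
show that the product of the dressed walls' entries is a constant times the product of the bare
walls' entries (`mul_eq_of_trace_word_eq`), so each dressed wall is proportional to its bare wall
(`exists_wallFactor`). Unitarity and nonvanishing of the wall states make the constant nonzero.

For the final relation, T_g T_h is evaluated on five sites around a wall. The fused endpoints give
B^{gh}_{x,y} and the successive ones give B^g_{hx,hy} B^h_{x,y}. Exchanging the endpoints costs
1/L^x on the left and L^y on the right. -/

namespace DomainWalls

/-! ### Injective tensors and the full matrix algebra -/

section Injective

variable {ι n : Type*} [Fintype n]

/-- A functional vanishing on every `A i` is given by a matrix of coefficients X, and its vanishing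
says exactly that `toPhysical A X = 0`; the left inverse forces X = 0. -/
theorem IsInjective.span_eq_top {A : Tensor ι n} (hA : IsInjective A) :
    Submodule.span ℂ (Set.range A) = ⊤ := by
  classical
  obtain ⟨Ainv, hinv⟩ := hA
  by_contra hne
  obtain ⟨φ, hφ, hle⟩ := Submodule.exists_le_ker_of_lt_top _ (lt_top_iff_ne_top.2 hne)
  apply hφ
  have hexp : ∀ Z : Matrix n n ℂ, φ Z = ∑ a, ∑ b, Z a b * φ (Matrix.single a b 1) := by
    intro Z
    conv_lhs => rw [Matrix.matrix_eq_sum_single Z]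
    simp only [map_sum]
    refine Finset.sum_congr rfl fun a _ => Finset.sum_congr rfl fun b _ => ?_
    rw [← smul_eq_mul, ← map_smul, Matrix.smul_single, smul_eq_mul, mul_one]
  obtain ⟨X, hX⟩ : ∃ X : Matrix n n ℂ, ∀ a b, X a b = φ (Matrix.single a b 1) :=
    ⟨fun a b => φ (Matrix.single a b 1), fun _ _ => rfl⟩
  have hzero : toPhysical A X = 0 := by
    funext i
    have h := hexp (A i)
    rw [show φ (A i) = 0 from hle (Submodule.subset_span ⟨i, rfl⟩)] at h
    simpa [toPhysical, hX] using h.symm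
  have hX0 : X = 0 := by
    have h := LinearMap.congr_fun hinv X
    rw [LinearMap.comp_apply, hzero, map_zero] at h
    exact h.symm
  ext Z
  rw [hexp]
  simp [← hX, hX0]

theorem IsInjective.linearMap_eq {A : Tensor ι n} (hA : IsInjective A) {N : Type*}
    [AddCommGroup N] [Module ℂ N] {f g : Matrix n n ℂ →ₗ[ℂ] N} (h : ∀ i, f (A i) = g (A i)) :
    f = g :=
  LinearMap.ext_on_range hA.span_eq_top h

/-- The linear map `Y ↦ X * Y * Z`. -/
def sandwich {m m' : Type*} (X : Matrix m n ℂ) (Z : Matrix n m' ℂ) :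
    Matrix n n ℂ →ₗ[ℂ] Matrix m m' ℂ where
  toFun Y := X * Y * Z
  map_add' Y Y' := by simp [Matrix.mul_add, Matrix.add_mul]
  map_smul' c Y := by simp

theorem sandwich_apply {m m' : Type*} (X : Matrix m n ℂ) (Z : Matrix n m' ℂ)
    (Y : Matrix n n ℂ) : sandwich X Z Y = X * Y * Z := rfl

theorem IsInjective.sandwich_eq {A : Tensor ι n} (hA : IsInjective A) {m m' : Type*}
    {X X' : Matrix m n ℂ} {Z Z' : Matrix n m' ℂ}
    (h : ∀ i, X * A i * Z = X' * A i * Z') (Y : Matrix n n ℂ) : X * Y * Z = X' * Y * Z' :=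
  LinearMap.congr_fun (hA.linearMap_eq (f := sandwich X Z) (g := sandwich X' Z') h) Y

theorem IsInjective.mul_left_cancel [DecidableEq n] {A : Tensor ι n} (hA : IsInjective A)
    {m : Type*} {X Y : Matrix n m ℂ} (h : ∀ i, A i * X = A i * Y) : X = Y := by
  simpa using hA.sandwich_eq (X := (1 : Matrix n n ℂ)) (X' := 1) (Z := X) (Z' := Y)
    (fun i => by simpa using h i) 1

theorem IsInjective.mul_right_cancel [DecidableEq n] {A : Tensor ι n} (hA : IsInjective A)
    {m : Type*} {X Y : Matrix m n ℂ} (h : ∀ i, X * A i = Y * A i) : X = Y := by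
  simpa using hA.sandwich_eq (X := X) (X' := Y) (Z := (1 : Matrix n n ℂ)) (Z' := 1)
    (fun i => by simpa using h i) 1

theorem IsInjective.exists_sum_smul_eq [Fintype ι] {A : Tensor ι n} (hA : IsInjective A)
    (X : Matrix n n ℂ) : ∃ c : ι → ℂ, ∑ i, c i • A i = X := by
  have h : X ∈ Submodule.span ℂ (Set.range A) := hA.span_eq_top ▸ Submodule.mem_top
  exact (Submodule.mem_span_range_iff_exists_fun ℂ).1 h

/-- Words of any fixed positive length also span. Length p + 1 excludes the empty word, which yields
only scalars. -/
theorem IsInjective.word_linearMap_eq [DecidableEq n] {A : Tensor ι n} (hA : IsInjective A)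
    {N : Type*} [AddCommGroup N] [Module ℂ N] (p : ℕ) {f g : Matrix n n ℂ →ₗ[ℂ] N}
    (h : ∀ w : List ι, w.length = p + 1 → f (word A w) = g (word A w)) : f = g := by
  induction p generalizing f g with
  | zero => exact hA.linearMap_eq fun i => by simpa [word] using h [i] rfl
  | succ p ih =>
    refine hA.linearMap_eq fun i => ?_
    have := ih (f := f ∘ₗ sandwich (A i) 1) (g := g ∘ₗ sandwich (A i) 1) fun w hw => by
      simpa [sandwich_apply, word] using h (i :: w) (by simp [hw])
    simpa [sandwich_apply] using LinearMap.congr_fun this 1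

theorem IsInjective.exists_smul_one_of_commute [DecidableEq n] {A : Tensor ι n}
    (hA : IsInjective A) {Y : Matrix n n ℂ} (h : ∀ i, A i * Y = Y * A i) :
    ∃ c : ℂ, Y = c • 1 := by
  have h' : ∀ X : Matrix n n ℂ, X * Y = Y * X := fun X => by
    simpa using hA.sandwich_eq (X := 1) (X' := Y) (Z := Y) (Z' := 1)
      (fun i => by simpa using h i) X
  obtain ⟨c, hc⟩ := Matrix.mem_range_scalar_of_commute_single (M := Y)
    fun i j _ => h' (Matrix.single i j 1)
  exact ⟨c, by rw [← hc, Matrix.scalar_apply, Matrix.smul_one_eq_diagonal]⟩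

end Injective

/-! ### Reductions: sliding of endpoints and uniqueness up to a scalar -/

section Reduction

variable {ι n k l : Type*} [Fintype n] [Fintype k] [Fintype l]

/-- `(P, Q)` reduces `M` to `A`, and the endpoints can be moved through the bulk as soon as one
site separates them from the end of the chain. -/
structure IsSlidingReduction (M : Tensor ι n) (A : Tensor ι k) (P : Matrix k n ℂ)
    (Q : Matrix n k ℂ) : Prop where
  reduce : ∀ i j, P * M i * M j * Q = A i * A j
  right : ∀ i j, M i * M j * Q = M i * Q * A j
  left : ∀ i j, P * M i * M j = A i * P * M j
  insert : ∀ i j m, M i * M j * M m = M i * Q * A j * P * M m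

/-- Insertion followed by reduction of the last site gives M M ⋯ M Q = M Q A ⋯ A on chains of three
and four sites. Comparing these lengths and cancelling the surplus A gives the two-site sliding
rule; the left endpoint is symmetric. -/
theorem IsReduction.isSlidingReduction [DecidableEq n] [DecidableEq k] {M : Tensor ι n}
    {A : Tensor ι k} {P : Matrix k n ℂ} {Q : Matrix n k ℂ} (h : IsReduction M A P Q)
    (hA : IsInjective A) : IsSlidingReduction M A P Q := by
  have r1 : ∀ i, P * M i * Q = A i := fun i => by simpa [word] using h.reduce [i]
  have r2 : ∀ i j, P * M i * M j * Q = A i * A j := fun i j => by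
    simpa [word, Matrix.mul_assoc] using h.reduce [i, j]
  have i3 : ∀ i j m, M i * M j * M m = M i * Q * A j * P * M m := fun i j m => by
    simpa [word] using h.insert i m [j] (by simp)
  have i4 : ∀ i j j' m, M i * M j * M j' * M m = M i * Q * A j * A j' * P * M m :=
    fun i j j' m => by
      simpa [word, ← Matrix.mul_assoc] using h.insert i m [j, j'] (by simp)
  have R2 : ∀ i j m, M i * M j * M m * Q = M i * Q * A j * A m := fun i j m => by
    rw [i3, ← r1 m]; simp only [Matrix.mul_assoc]
  have R3 : ∀ i j j' m, M i * M j * M j' * M m * Q = M i * Q * A j * A j' * A m :=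
    fun i j j' m => by
      rw [i4, ← r1 m]; simp only [Matrix.mul_assoc]
  have L2 : ∀ i j m, P * M i * M j * M m = A i * A j * P * M m := fun i j m => by
    have := congrArg (P * ·) (i3 i j m)
    simp only [← Matrix.mul_assoc] at this
    rw [this, r1]
  have L3 : ∀ i j j' m, P * M i * M j * M j' * M m = A i * A j * A j' * P * M m :=
    fun i j j' m => by
      have := congrArg (P * ·) (i4 i j j' m)
      simp only [← Matrix.mul_assoc] at this
      rw [this, r1]
  -- After appending A_m, both sides equal M_a M_i M_j M_m Q: one by absorbing all of A_i A_j A_m,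
  -- the other by sliding within the last three sites only.
  have s1 : ∀ a i j, M a * M i * M j * Q = M a * M i * Q * A j := fun a i j =>
    hA.mul_right_cancel fun m => by
      have := congrArg (M a * ·) (R2 i j m)
      simp only [← Matrix.mul_assoc] at this
      rw [R2, ← this, R3]
  have t1 : ∀ i j a, P * M i * M j * M a = A i * P * M j * M a := fun i j a =>
    hA.mul_left_cancel fun m => by
      have := congrArg (· * M a) (L2 m i j)
      simp only [← Matrix.mul_assoc]
      rw [← this, L3, Matrix.mul_assoc, Matrix.mul_assoc, Matrix.mul_assoc,
        ← Matrix.mul_assoc P, ← Matrix.mul_assoc (P * M i), L2]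
      simp only [← Matrix.mul_assoc]
  refine ⟨r2, fun i j => hA.mul_right_cancel fun m => ?_, fun i j =>
    hA.mul_left_cancel fun m => ?_, i3⟩
  · rw [← s1, R2]
  · have := t1 m i j
    simp only [← Matrix.mul_assoc]
    rw [← this, L2]

/-- `(P, Q)` reduces `M` to `A`, and the endpoints can be moved through the bulk as soon as two
sites separate them from the end of the chain. -/
structure IsDeepReduction (M : Tensor ι n) (A : Tensor ι k) (P : Matrix k n ℂ)
    (Q : Matrix n k ℂ) : Prop where
  reduce : ∀ i j, P * M i * M j * Q = A i * A j
  right : ∀ i j m, M i * M j * M m * Q = M i * M j * Q * A m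
  left : ∀ i j m, P * M i * M j * M m = A i * P * M j * M m
  insert : ∀ i j m a b, M i * M j * M m * M a * M b = M i * M j * Q * A m * P * M a * M b

/-- The inner endpoint slides past one site of M, and the outer one needs in addition a site of N,
so the composite needs two shielding sites. -/
theorem IsSlidingReduction.comp {M : Tensor ι n} {N : Tensor ι k} {A : Tensor ι l}
    {P : Matrix k n ℂ} {Q : Matrix n k ℂ} {P' : Matrix l k ℂ} {Q' : Matrix k l ℂ}
    (h : IsSlidingReduction M N P Q) (h' : IsSlidingReduction N A P' Q') :
    IsDeepReduction M A (P' * P) (Q * Q') where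
  reduce i j := by
    rw [← h'.reduce, Matrix.mul_assoc P', Matrix.mul_assoc P', Matrix.mul_assoc P',
      ← Matrix.mul_assoc _ Q, h.reduce]
    simp only [← Matrix.mul_assoc]
  right i j m := by
    have := congrArg (M i * Q * ·) (h'.right j m)
    simp only [← Matrix.mul_assoc] at this ⊢
    have e := congrArg (M i * ·) (h.right j m)
    simp only [← Matrix.mul_assoc] at e
    rw [e, h.right, this]
  left i j m := by
    have := congrArg (· * P * M m) (h'.left i j)
    have e := congrArg (P' * · * M m) (h.left i j)
    have e' := congrArg (P' * N i * ·) (h.left j m)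
    have e'' := congrArg (A i * P' * ·) (h.left j m)
    simp only [← Matrix.mul_assoc] at this e e' e'' ⊢
    rw [e, e', this, e'']
  insert i j m a b := by
    have e1 := congrArg (M i * ·) (congrArg (· * M b) (h.insert j m a))
    have e2 := congrArg (M i * M j * Q * N m * ·) (h.left a b)
    have e3 := congrArg (M i * Q * · * P * M b) (h'.insert j m a)
    have e4 := congrArg (M i * M j * Q * Q' * A m * P' * ·) (h.left a b)
    have e5 := h.right i j
    simp only [← Matrix.mul_assoc] at e1 e2 e3 e4 ⊢
    rw [e1, e2, e4, e5, e3]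

variable [DecidableEq k]

/-- Evaluating one chain closed by Q, once by sliding Q and once by inserting the primed pair,
relates Q to Q' Y for an overlap matrix Y; Y then commutes with A. -/
theorem IsDeepReduction.exists_right_smul [Fintype ι] {M : Tensor ι n} {A : Tensor ι k}
    {P P' : Matrix k n ℂ} {Q Q' : Matrix n k ℂ} (h : IsDeepReduction M A P Q)
    (h' : IsDeepReduction M A P' Q') (hA : IsInjective A) :
    ∃ c : ℂ, ∀ i j, M i * M j * Q = c • (M i * M j * Q') := by
  obtain ⟨c, hc⟩ := hA.exists_sum_smul_eq 1
  -- The weights `c` satisfy ∑ c_a A_a = 1, so they remove the two auxiliary sites and collect the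
  -- overlap of P' with Q into Y.
  obtain ⟨Y, hY⟩ : ∃ Y : Matrix k k ℂ, Y = ∑ a, ∑ b, c b • c a • (P' * M a * M b * Q) :=
    ⟨_, rfl⟩
  have key : ∀ i j m, M i * M j * Q * A m = M i * M j * Q' * A m * Y := fun i j m => by
    have e : ∀ a b, M i * M j * Q * A m * A a * A b
        = M i * M j * Q' * A m * (P' * M a * M b * Q) := fun a b => by
      have e1 := congrArg (· * Q) (h'.insert i j m a b)
      have e2 := congrArg (M i * M j * ·) (h.right m a b)
      have e3 := congrArg (M i * ·) (h.right j m a)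
      simp only [← Matrix.mul_assoc] at e1 e2 e3 ⊢
      rw [← e1, e2, e3, h.right]
    calc M i * M j * Q * A m
        = M i * M j * Q * A m * (∑ a, c a • A a) * (∑ b, c b • A b) := by simp [hc]
      _ = M i * M j * Q' * A m * Y := by
        rw [hY]
        simp only [Matrix.mul_sum, Matrix.sum_mul, Matrix.mul_smul, Matrix.smul_mul, e,
          Finset.smul_sum]
        rw [Finset.sum_comm]
  have key' : ∀ i j (X : Matrix k k ℂ), M i * M j * Q * X = M i * M j * Q' * X * Y := fun i j X => by
    simpa using hA.sandwich_eq (X := M i * M j * Q) (X' := M i * M j * Q') (Z := 1) (Z' := Y)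
      (fun m => by simpa using key i j m) X
  have hQ : ∀ i j, M i * M j * Q = M i * M j * Q' * Y := fun i j => by
    simpa using key' i j 1
  -- Both M_i M_j Q' A_m Y and M_i M_j Q' Y A_m equal M_i M_j Q A_m; applying P' and cancelling A_i
  -- A_j leaves A_m Y = Y A_m.
  obtain ⟨μ, hμ⟩ := hA.exists_smul_one_of_commute (Y := Y) fun m =>
    hA.mul_left_cancel fun j => hA.mul_left_cancel fun i => by
      have e := congrArg (P' * ·) ((key i j m).symm.trans (congrArg (· * A m) (hQ i j)))
      simp only [← Matrix.mul_assoc, h'.reduce] at e ⊢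
      exact e
  exact ⟨μ, fun i j => by rw [hQ, hμ]; simp⟩

theorem IsDeepReduction.exists_left_smul [Fintype ι] {M : Tensor ι n} {A : Tensor ι k}
    {P P' : Matrix k n ℂ} {Q Q' : Matrix n k ℂ} (h : IsDeepReduction M A P Q)
    (h' : IsDeepReduction M A P' Q') (hA : IsInjective A) :
    ∃ c : ℂ, ∀ i j, P * M i * M j = c • (P' * M i * M j) := by
  obtain ⟨c, hc⟩ := hA.exists_sum_smul_eq 1
  obtain ⟨Y, hY⟩ : ∃ Y : Matrix k k ℂ, Y = ∑ a, ∑ b, c a • c b • (P * M b * M a * Q') :=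
    ⟨_, rfl⟩
  have key : ∀ m i j, A m * (P * M i * M j) = Y * A m * (P' * M i * M j) := fun m i j => by
    have e : ∀ a b, A b * A a * A m * P * M i * M j
        = P * M b * M a * Q' * A m * P' * M i * M j := fun a b => by
      have e1 := congrArg (P * ·) (h'.insert b a m i j)
      have e2 := congrArg (· * M i * M j) (h.left b a m)
      have e3 := congrArg (A b * · * M j) (h.left a m i)
      have e4 := congrArg (A b * A a * ·) (h.left m i j)
      simp only [← Matrix.mul_assoc] at e1 e2 e3 e4 ⊢
      rw [← e1, e2, e3, e4]
    calc A m * (P * M i * M j)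
        = (∑ b, c b • A b) * (∑ a, c a • A a) * A m * P * M i * M j := by
          simp [hc, Matrix.mul_assoc]
      _ = Y * A m * (P' * M i * M j) := by
        rw [hY]
        simp only [Matrix.mul_sum, Matrix.sum_mul, Matrix.mul_smul, Matrix.smul_mul, e,
          ← Matrix.mul_assoc, Finset.smul_sum]
  have hP : ∀ i j, P * M i * M j = Y * (P' * M i * M j) := fun i j => by
    simpa using hA.sandwich_eq (X := 1) (X' := Y) (Z := P * M i * M j)
      (Z' := P' * M i * M j) (fun m => by simpa using key m i j) 1
  obtain ⟨μ, hμ⟩ := hA.exists_smul_one_of_commute (Y := Y) fun m =>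
    hA.mul_right_cancel fun i => hA.mul_right_cancel fun j => by
      have e := congrArg (· * Q') ((congrArg (A m * ·) (hP i j)).symm.trans (key m i j))
      have r := h'.reduce i j
      simp only [Matrix.mul_assoc] at e r ⊢
      rw [r] at e
      exact e
  exact ⟨μ, fun i j => by rw [hP, hμ]; simp⟩

end Reduction

/-! ### Contraction along physical indices -/

section Contract

variable {ι κ κ' a a' b c c' f m : Type*}

/-- Contraction of two families of matrices along a common physical index. -/
def contract [Fintype κ] (S : κ → Matrix c c' ℂ) (M : κ → Matrix a b ℂ) :
    Matrix (c × a) (c' × b) ℂ :=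
  ∑ j, S j ⊗ₖ M j

theorem applyMPO_eq_contract [Fintype ι] (T : Tensor (ι × ι) c) (M : ι → Matrix a b ℂ) (i : ι) :
    applyMPO T M i = contract (fun j => T (i, j)) M := rfl

theorem contract_mul_contract [Fintype κ] [Fintype κ'] [Fintype c'] [Fintype b]
    (S : κ → Matrix c c' ℂ) (M : κ → Matrix a b ℂ) (S' : κ' → Matrix c' f ℂ)
    (M' : κ' → Matrix b m ℂ) :
    contract S M * contract S' M'
      = contract (fun p : κ × κ' => S p.1 * S' p.2) (fun p => M p.1 * M' p.2) := by
  simp only [contract, Matrix.mul_sum, Matrix.sum_mul, ← Matrix.mul_kronecker_mul,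
    Fintype.sum_prod_type]
  rw [Finset.sum_comm]

theorem one_kronecker_mul_contract [Fintype κ] [Fintype c] [DecidableEq c] [Fintype a]
    (P : Matrix a' a ℂ) (S : κ → Matrix c c' ℂ) (M : κ → Matrix a b ℂ) :
    ((1 : Matrix c c ℂ) ⊗ₖ P) * contract S M = contract S (fun j => P * M j) := by
  simp only [contract, Matrix.mul_sum, ← Matrix.mul_kronecker_mul, Matrix.one_mul]

theorem contract_mul_one_kronecker [Fintype κ] [Fintype c'] [DecidableEq c'] [Fintype b]
    (Q : Matrix b a' ℂ) (S : κ → Matrix c c' ℂ) (M : κ → Matrix a b ℂ) :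
    contract S M * ((1 : Matrix c' c' ℂ) ⊗ₖ Q) = contract S (fun j => M j * Q) := by
  simp only [contract, Matrix.sum_mul, ← Matrix.mul_kronecker_mul, Matrix.mul_one]

theorem kronecker_one_mul_contract [Fintype κ] [Fintype c] [Fintype a] [DecidableEq a]
    (P : Matrix f c ℂ) (S : κ → Matrix c c' ℂ) (M : κ → Matrix a b ℂ) :
    (P ⊗ₖ (1 : Matrix a a ℂ)) * contract S M = contract (fun j => P * S j) M := by
  simp only [contract, Matrix.mul_sum, ← Matrix.mul_kronecker_mul, Matrix.one_mul]

theorem contract_mul_kronecker_one [Fintype κ] [Fintype c'] [Fintype b] [DecidableEq b]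
    (Q : Matrix c' f ℂ) (S : κ → Matrix c c' ℂ) (M : κ → Matrix a b ℂ) :
    contract S M * (Q ⊗ₖ (1 : Matrix b b ℂ)) = contract (fun j => S j * Q) M := by
  simp only [contract, Matrix.sum_mul, ← Matrix.mul_kronecker_mul, Matrix.mul_one]

theorem contract_smul [Fintype κ] (r : ℂ) (S : κ → Matrix c c' ℂ) (M : κ → Matrix a b ℂ) :
    contract S (fun j => r • M j) = r • contract S M := by
  simp only [contract, Matrix.kronecker_smul, Finset.smul_sum]

theorem trace_contract [Fintype κ] [Fintype a] [Fintype c] (S : κ → Matrix c c ℂ)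
    (M : κ → Matrix a a ℂ) :
    (contract S M).trace = ∑ j, (S j).trace * (M j).trace := by
  simp only [contract, Matrix.trace_sum, Matrix.trace_kronecker]

theorem applyMPO_applyMPO [Fintype ι] (T : Tensor (ι × ι) c) (S : Tensor (ι × ι) f)
    (M : ι → Matrix a b ℂ) (i : ι) :
    applyMPO T (applyMPO S M) i = (applyMPO (stackMPO T S) M i).submatrix
      (Equiv.prodAssoc c f a).symm (Equiv.prodAssoc c f b).symm := by
  ext ⟨x, y, z⟩ ⟨x', y', z'⟩
  simp only [applyMPO, stackMPO, Matrix.sum_apply, Matrix.kroneckerMap_apply,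
    Matrix.submatrix_apply, Equiv.prodAssoc_symm_apply, Finset.mul_sum, Finset.sum_mul, mul_assoc]
  rw [Finset.sum_comm]

theorem word_applyMPO [Fintype ι] [Fintype c] [DecidableEq c] [Fintype a] [DecidableEq a]
    (T : Tensor (ι × ι) c) (A : Tensor ι a) {p : ℕ} (u : Fin p → ι) :
    word (applyMPO T A) (List.ofFn u)
      = contract (fun u' : Fin p → ι => word T (List.ofFn fun k => (u k, u' k)))
          (fun u' => word A (List.ofFn u')) := by
  induction p with
  | zero => simp [word, contract]
  | succ p ih =>
    have e : word (applyMPO T A) (List.ofFn u)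
        = applyMPO T A (u 0) * word (applyMPO T A) (List.ofFn fun k => u k.succ) := by
      simp [word, List.ofFn_succ]
    rw [e, ih, applyMPO_eq_contract, contract_mul_contract, contract, contract]
    refine Fintype.sum_equiv (Fin.consEquiv fun _ => ι) _ _ fun x => ?_
    simp [word, List.ofFn_succ, Fin.consEquiv]

end Contract

theorem mul_submatrix_id {l m m' n : Type*} [Fintype l] (X : Matrix n l ℂ) (Y : Matrix l m ℂ)
    (e : m' → m) : X * Y.submatrix id e = (X * Y).submatrix id e := rfl

theorem submatrix_id_mul {l m m' n : Type*} [Fintype l] (X : Matrix m l ℂ) (Y : Matrix l n ℂ)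
    (e : m' → m) : X.submatrix e id * Y = (X * Y).submatrix e id := rfl

/-! ### Stability of reductions under stacking and reindexing -/

section Reduction

variable {ι n n' k c c' : Type*} [Fintype n] [Fintype k]
  {M : Tensor ι n} {A : Tensor ι k} {P : Matrix k n ℂ} {Q : Matrix n k ℂ}

theorem IsSlidingReduction.applyMPO [Fintype ι] [Fintype c] [DecidableEq c]
    (h : IsSlidingReduction M A P Q) (T : Tensor (ι × ι) c) :
    IsSlidingReduction (applyMPO T M) (applyMPO T A) (1 ⊗ₖ P) (1 ⊗ₖ Q) := by
  constructor <;> intros <;>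
    simp only [applyMPO_eq_contract, contract_mul_contract, one_kronecker_mul_contract,
      contract_mul_one_kronecker]
  · simp only [h.reduce]
  · simp only [h.right]
  · simp only [h.left]
  · simp only [h.insert]

theorem IsSlidingReduction.stack [Fintype ι] [Fintype c] [Fintype c'] {m : Type*}
    [Fintype m] [DecidableEq m] {T : Tensor (ι × ι) c} {T' : Tensor (ι × ι) c'} {V : Matrix c c' ℂ} {Vhat : Matrix c' c ℂ}
    (h : IsSlidingReduction T T' Vhat V) (B : Tensor ι m) :
    IsSlidingReduction (DomainWalls.applyMPO T B) (DomainWalls.applyMPO T' B)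
      (Vhat ⊗ₖ 1) (V ⊗ₖ 1) := by
  constructor <;> intros <;>
    simp only [applyMPO_eq_contract, contract_mul_contract, kronecker_one_mul_contract,
      contract_mul_kronecker_one]
  · simp only [h.reduce]
  · simp only [h.right]
  · simp only [h.left]
  · simp only [h.insert]

theorem IsSlidingReduction.reindex [Fintype n'] (h : IsSlidingReduction M A P Q) (e : n' ≃ n) :
    IsSlidingReduction (fun i => (M i).submatrix e e) A (P.submatrix id e)
      (Q.submatrix e id) where
  reduce i j := by
    simp only [Matrix.submatrix_mul_equiv, h.reduce, Matrix.submatrix_id_id]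
  right i j := by
    simp only [Matrix.submatrix_mul_equiv, h.right, submatrix_id_mul]
  left i j := by
    simp only [Matrix.submatrix_mul_equiv, h.left, mul_submatrix_id]
  insert i j m := by
    rw [Matrix.submatrix_mul_equiv, Matrix.submatrix_mul_equiv, h.insert,
      ← Matrix.submatrix_mul_equiv _ _ e e e, Matrix.submatrix_mul_equiv (M i) Q e e id]
    rfl

end Reduction

/-! ### Cutting a ring into two wall sites and two arcs -/

section Split

variable {α : Type*}

/-- The sites of a ring of length `p + q + 2`, separated into two single sites and two arcs. -/
def splitRing (p q : ℕ) (i : Fin (p + q + 2) → α) :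
    ((α × (Fin p → α)) × α) × (Fin q → α) :=
  (((i ⟨0, by omega⟩, fun k => i ⟨k + 1, by omega⟩), i ⟨p + 1, by omega⟩),
    fun k => i ⟨p + 2 + k, by omega⟩)

theorem splitRing_bijective (p q : ℕ) : Function.Bijective (splitRing (α := α) p q) := by
  constructor
  · intro i j h
    simp only [splitRing, Prod.mk.injEq] at h
    obtain ⟨⟨⟨h1, h2⟩, h3⟩, h4⟩ := h
    funext ⟨k, hk⟩
    rcases Nat.eq_zero_or_pos k with rfl | hk0
    · exact h1
    rcases Nat.lt_trichotomy k (p + 1) with hlt | rfl | hgt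
    · have := congr_fun h2 ⟨k - 1, by omega⟩
      simpa only [Nat.sub_add_cancel hk0] using this
    · exact h3
    · have := congr_fun h4 ⟨k - (p + 2), by omega⟩
      simpa only [Nat.add_sub_cancel' (show p + 2 ≤ k from hgt)] using this
  · rintro ⟨⟨⟨a, u⟩, b⟩, v⟩
    refine ⟨fun k => if h0 : k.1 = 0 then a else if h1 : k.1 < p + 1 then u ⟨k.1 - 1, by omega⟩
      else if h2 : k.1 = p + 1 then b else v ⟨k.1 - (p + 2), by omega⟩, ?_⟩
    simp only [splitRing, Prod.mk.injEq]
    refine ⟨⟨⟨by simp, ?_⟩, by simp⟩, ?_⟩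
    · funext k; simp
    · funext k
      rw [dif_neg (by omega), dif_neg (by omega), dif_neg (by omega)]
      simp

theorem ofFn_eq_splitRing (p q : ℕ) (i : Fin (p + q + 2) → α) :
    List.ofFn i = (splitRing p q i).1.1.1 :: (List.ofFn (splitRing p q i).1.1.2
      ++ (splitRing p q i).1.2 :: List.ofFn (splitRing p q i).2) := by
  refine List.ext_getElem (by simp; omega) fun k h1 h2 => ?_
  simp only [List.getElem_ofFn, List.getElem_cons, List.getElem_append, List.length_ofFn,
    splitRing]
  split_ifs <;> congr 1 <;> simp only [Fin.mk.injEq] <;> omega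

theorem exists_splitRing_eq {p q : ℕ} (a b : α) (w v : List α) (hw : w.length = p)
    (hv : v.length = q) : ∃ i, (splitRing p q i).1.1.1 = a
      ∧ List.ofFn (splitRing p q i).1.1.2 = w ∧ (splitRing p q i).1.2 = b
      ∧ List.ofFn (splitRing p q i).2 = v := by
  subst hw hv
  obtain ⟨i, hi⟩ := (splitRing_bijective w.length v.length).2 (((a, w.get), b), v.get)
  exact ⟨i, by rw [hi], by rw [hi, List.ofFn_get], by rw [hi], by rw [hi, List.ofFn_get]⟩

end Split

theorem wallState_apply {d : ℕ} {I : Type*} {D : I → ℕ} (A : ∀ x, Tensor (Fin d) (Fin (D x)))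
    (e : ∀ x y, Fin d → Matrix (Fin (D x)) (Fin (D y)) ℂ) (x y : I) (p q : ℕ)
    (i : Fin (p + q + 2) → Fin d) :
    wallState A e x y p q i
      = (e x y (splitRing p q i).1.1.1 * word (A y) (List.ofFn (splitRing p q i).1.1.2)
          * e y x (splitRing p q i).1.2 * word (A x) (List.ofFn (splitRing p q i).2)).trace := rfl

theorem mpo_mulVec_wallState {d χ : ℕ} {I : Type*} {D : I → ℕ}
    (T : Tensor (Fin d × Fin d) (Fin χ)) (A : ∀ x, Tensor (Fin d) (Fin (D x)))
    (e : ∀ x y, Fin d → Matrix (Fin (D x)) (Fin (D y)) ℂ) (x y : I) (p q : ℕ)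
    (i : Fin (p + q + 2) → Fin d) :
    (mpo T (p + q + 2)).mulVec (wallState A e x y p q) i
      = (applyMPO T (e x y) (splitRing p q i).1.1.1
          * word (applyMPO T (A y)) (List.ofFn (splitRing p q i).1.1.2)
          * applyMPO T (e y x) (splitRing p q i).1.2
          * word (applyMPO T (A x)) (List.ofFn (splitRing p q i).2)).trace := by
  rw [word_applyMPO, word_applyMPO, applyMPO_eq_contract, applyMPO_eq_contract,
    contract_mul_contract, contract_mul_contract, contract_mul_contract, trace_contract]
  refine Fintype.sum_equiv (Equiv.ofBijective _ (splitRing_bijective p q)) _ _ fun j => ?_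
  simp only [Equiv.ofBijective_apply]
  congr 1
  simp only [mpo, Matrix.of_apply]
  rw [ofFn_eq_splitRing]
  simp [word, splitRing, Matrix.mul_assoc]

/-! ### The two endpoint scalars are mutually inverse -/

section Scalars

variable {ι n k : Type*} [Fintype n] [Fintype k] [DecidableEq k] [Nonempty k]
  {M : Tensor ι n} {A : Tensor ι k} {P P' : Matrix k n ℂ} {Q Q' : Matrix n k ℂ}

theorem IsDeepReduction.exists_ne_zero (h : IsDeepReduction M A P Q) (hA : IsInjective A) :
    ∃ i j m, M i * M j * M m * Q ≠ 0 := by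
  by_contra! h0
  refine one_ne_zero (α := Matrix k k ℂ) (hA.mul_left_cancel fun m => hA.mul_left_cancel fun j =>
    hA.mul_left_cancel fun i => ?_)
  have e := congrArg (P * ·) ((h.right i j m).symm.trans (h0 i j m))
  simp only [← Matrix.mul_assoc, h.reduce] at e
  simpa [Matrix.mul_assoc] using e

theorem IsDeepReduction.exists_smul [Fintype ι] (h : IsDeepReduction M A P Q)
    (h' : IsDeepReduction M A P' Q') (hA : IsInjective A) :
    ∃ r s : ℂ, s * r = 1 ∧ (∀ i j, M i * M j * Q = r • (M i * M j * Q')) ∧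
      ∀ i j, P * M i * M j = s • (P' * M i * M j) := by
  obtain ⟨r, hr⟩ := h.exists_right_smul h' hA
  obtain ⟨s, hs⟩ := h.exists_left_smul h' hA
  refine ⟨r, s, ?_, hr, hs⟩
  by_contra hne
  refine one_ne_zero (α := Matrix k k ℂ) (hA.mul_left_cancel fun l => hA.mul_left_cancel fun m =>
    hA.mul_left_cancel fun j => hA.mul_left_cancel fun i => ?_)
  -- Four sites give each endpoint its two shielding sites, so both scalars can be extracted from
  -- the same chain.
  have four : ∀ {P : Matrix k n ℂ} {Q : Matrix n k ℂ}, IsDeepReduction M A P Q →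
      P * M i * M j * (M m * M l * Q) = A i * (A j * (A m * A l)) := fun {P Q} h => by
    have e := congrArg (P * M i * ·) (h.right j m l)
    have e' := congrArg (P * ·) (h.right i j m)
    simp only [← Matrix.mul_assoc] at e e' ⊢
    rw [e, e', h.reduce]
  have e := four h
  rw [hr, hs, Matrix.smul_mul, Matrix.mul_smul, four h', smul_smul] at e
  have e0 : (s * r - 1) • (A i * (A j * (A m * A l))) = 0 := by
    rw [sub_smul, e, one_smul, sub_self]
  simpa using (smul_eq_zero.1 e0).resolve_left (sub_ne_zero.2 hne)

end Scalars

/-! ### Separating the two walls of a ring -/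

section Trace

theorem exists_apply_ne_zero {m n : Type*} {X : Matrix m n ℂ} (h : X ≠ 0) :
    ∃ i j, X i j ≠ 0 := by
  by_contra! h0
  exact h (Matrix.ext h0)

variable {ι n k : Type*} [Fintype n] [DecidableEq n] [Fintype k] [DecidableEq k]

/-- Words on each arc span, so they may be replaced by matrix units, which cut the ring and isolate
one entry of each wall. -/
theorem mul_eq_of_trace_word_eq {A : Tensor ι n} {A' : Tensor ι k} (hA : IsInjective A)
    (hA' : IsInjective A') {p q : ℕ} {F E : Matrix k n ℂ} {F' E' : Matrix n k ℂ} {r : ℂ}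
    (h : ∀ w v : List ι, w.length = p + 1 → v.length = q + 1 →
      (F * word A w * F' * word A' v).trace = r * (E * word A w * E' * word A' v).trace)
    (a : k) (b b' : n) (a' : k) : F a b * F' b' a' = r * (E a b * E' b' a') := by
  have h1 : ∀ (X : Matrix n n ℂ) (v : List ι), v.length = q + 1 →
      (F * X * F' * word A' v).trace = r * (E * X * E' * word A' v).trace := fun X v hv => by
    have := hA.word_linearMap_eq p
      (f := Matrix.traceLinearMap k ℂ ℂ ∘ₗ sandwich F (F' * word A' v))
      (g := r • Matrix.traceLinearMap k ℂ ℂ ∘ₗ sandwich E (E' * word A' v))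
      fun w hw => by simpa [sandwich_apply, Matrix.mul_assoc] using h w v hw hv
    simpa [sandwich_apply, Matrix.mul_assoc] using LinearMap.congr_fun this X
  have h2 : ∀ (X : Matrix n n ℂ) (Y : Matrix k k ℂ),
      (F * X * F' * Y).trace = r * (E * X * E' * Y).trace := fun X Y => by
    have := hA'.word_linearMap_eq q
      (f := Matrix.traceLinearMap k ℂ ℂ ∘ₗ sandwich (F * X * F') 1)
      (g := r • Matrix.traceLinearMap k ℂ ℂ ∘ₗ sandwich (E * X * E') 1)
      fun v hv => by simpa [sandwich_apply] using h1 X v hv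
    simpa [sandwich_apply] using LinearMap.congr_fun this Y
  have h3 : ∀ (F : Matrix k n ℂ) (F' : Matrix n k ℂ),
      (F * Matrix.single b b' (1 : ℂ) * F' * Matrix.single a' a (1 : ℂ)).trace = F a b * F' b' a' := by
    intro F F'
    simp [Matrix.trace, Matrix.mul_apply, Matrix.single_apply, ite_and]
  simpa only [h3] using h2 (Matrix.single b b' 1) (Matrix.single a' a 1)

theorem exists_mul_mul_ne_zero {A : Tensor ι k} {A' : Tensor ι n} (hA : IsInjective A)
    (hA' : IsInjective A') {e : ι → Matrix k n ℂ} (he : e ≠ 0) :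
    ∃ i j m, A i * e j * A' m ≠ 0 := by
  by_contra! h
  refine he (funext fun j => hA'.mul_right_cancel fun m => hA.mul_left_cancel fun i => ?_)
  simpa [Matrix.mul_assoc] using h i j m

end Trace

/-! ### Existence of the wall factors -/

section Walls

variable {G : Type*} [Group G] {d : ℕ} {R : MPURep G d}
  {I : Type*} [MulAction G I] {S : GroundStates R I}

theorem WallTensors.wallState_ne_zero (E : WallTensors S) (x y : I) (p q : ℕ) :
    wallState S.A E.e x y (p + 1) (q + 1) ≠ 0 := by
  intro h
  obtain ⟨a, ha⟩ := Function.ne_iff.1 (E.ne_zero x y)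
  obtain ⟨b, hb⟩ := Function.ne_iff.1 (E.ne_zero y x)
  obtain ⟨s, t, ht⟩ := exists_apply_ne_zero ha
  obtain ⟨s', t', ht'⟩ := exists_apply_ne_zero hb
  have key := mul_eq_of_trace_word_eq (S.injective y) (S.injective x) (p := p) (q := q)
    (F := E.e x y a) (F' := E.e y x b) (E := 0) (E' := 0) (r := 0) (fun w v hw hv => by
      obtain ⟨i, rfl, rfl, rfl, rfl⟩ := exists_splitRing_eq a b w v hw hv
      have := congr_fun h i
      rw [wallState_apply] at this
      simpa using this) s t s' t'
  rw [zero_mul] at key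
  exact (mul_ne_zero ht ht') key

/-- The arcs have length p + 3 so that each dressed wall can absorb one site on either side and p +
1 sites, a nonempty word, remain in between. -/
theorem WallTensors.exists_trace_eq (E : WallTensors S) : ∃ p : ℕ, ∀ (g : G) (x y : I),
    ∃ c : ℂ, c ≠ 0 ∧ ∀ (a b : Fin d) (w v : List (Fin d)), w.length = p + 3 → v.length = p + 3 →
      (applyMPO (R.T g) (E.e x y) a * word (applyMPO (R.T g) (S.A y)) w
          * applyMPO (R.T g) (E.e y x) b * word (applyMPO (R.T g) (S.A x)) v).trace
        = c * (E.e (g • x) (g • y) a * word (S.A (g • y)) w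
          * E.e (g • y) (g • x) b * word (S.A (g • x)) v).trace := by
  obtain ⟨p, hp⟩ := E.permute
  refine ⟨p, fun g x y => ?_⟩
  obtain ⟨c, hc⟩ := hp (p + 3) (p + 3) (by omega) (by omega) g x y
  refine ⟨c, ?_, fun a b w v hw hv => ?_⟩
  -- With c = 0 the unitary would annihilate a nonzero wall state.
  · rintro rfl
    rw [zero_smul] at hc
    have hU := (Matrix.mem_unitaryGroup_iff').1
      (R.unitary (p + 3 + (p + 3) + 2) (by omega) g)
    apply E.wallState_ne_zero x y (p + 2) (p + 2)
    rw [← Matrix.one_mulVec (wallState S.A E.e x y (p + 2 + 1) (p + 2 + 1)), ← hU,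
      ← Matrix.mulVec_mulVec, hc, Matrix.mulVec_zero]
  · obtain ⟨i, rfl, rfl, rfl, rfl⟩ := exists_splitRing_eq a b w v hw hv
    have := congr_fun hc i
    rwa [mpo_mulVec_wallState, Pi.smul_apply, wallState_apply, smul_eq_mul] at this

/-- A ring only controls the product of both dressed walls; fixing a nonzero entry of the second one
yields the proportionality for the first. -/
theorem exists_wallFactor (K : ActionTensors S) (E : WallTensors S) (g : G) (x y : I) :
    ∃ B : ℂ, B ≠ 0 ∧ ∀ i j k,
      K.What g (rfl : g • x = g • x)
          * applyMPO (R.T g) (S.A x) i * applyMPO (R.T g) (E.e x y) j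
          * applyMPO (R.T g) (S.A y) k * K.W g (rfl : g • y = g • y)
        = B • (S.A (g • x) i * E.e (g • x) (g • y) j * S.A (g • y) k) := by
  obtain ⟨p, hp⟩ := E.exists_trace_eq
  obtain ⟨c, hc, htr⟩ := hp g x y
  have key : ∀ i j k i' j' k', ∀ s t t' s', (K.What g (rfl : g • x = g • x)
          * applyMPO (R.T g) (S.A x) i * applyMPO (R.T g) (E.e x y) j
          * applyMPO (R.T g) (S.A y) k * K.W g (rfl : g • y = g • y)) s t
        * (K.What g (rfl : g • y = g • y)
          * applyMPO (R.T g) (S.A y) k' * applyMPO (R.T g) (E.e y x) j'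
          * applyMPO (R.T g) (S.A x) i' * K.W g (rfl : g • x = g • x)) t' s'
      = c * ((S.A (g • x) i * E.e (g • x) (g • y) j * S.A (g • y) k) s t
        * (S.A (g • y) k' * E.e (g • y) (g • x) j' * S.A (g • x) i') t' s') := by
    intro i j k i' j' k'
    refine mul_eq_of_trace_word_eq (S.injective _) (S.injective _) (p := p) (q := p)
      fun w v hw hv => ?_
    have h := htr j j' (k :: (w ++ [k'])) (i' :: (v ++ [i])) (by simp [hw]) (by simp [hv])
    have word_eq : ∀ {n : Type} [Fintype n] [DecidableEq n] (M : Tensor (Fin d) n) (a b)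
        (w : List (Fin d)), word M (a :: (w ++ [b])) = M a * word M w * M b := by
      intro n _ _ M a b w
      simp [word, Matrix.mul_assoc]
    -- Action tensors are inserted at both ends of each arc's interior; cyclicity of the trace then
    -- regroups the ring into the two dressed walls.
    rw [word_eq, word_eq, word_eq, word_eq, (K.isReduction g rfl).insert _ _ w (by aesop),
      (K.isReduction g rfl).insert _ _ v (by aesop)] at h
    simp only [Matrix.mul_assoc] at h ⊢
    rw [Matrix.trace_mul_comm (K.What g _), Matrix.mul_assoc,
      Matrix.trace_mul_comm (applyMPO (R.T g) (S.A x) i),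
      Matrix.trace_mul_comm (S.A (g • x) i)]
    simp only [Matrix.mul_assoc]
    exact h
  obtain ⟨i', j', k', h'⟩ := exists_mul_mul_ne_zero (S.injective (g • y)) (S.injective (g • x))
    (E.ne_zero (g • y) (g • x))
  obtain ⟨i, j, k, h⟩ := exists_mul_mul_ne_zero (S.injective (g • x)) (S.injective (g • y))
    (E.ne_zero (g • x) (g • y))
  obtain ⟨s, t, ht⟩ := exists_apply_ne_zero h
  obtain ⟨t', s', hs'⟩ := exists_apply_ne_zero h'
  have hF := right_ne_zero_of_mul ((key i j k k' j' i' s t t' s').trans_ne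
    (mul_ne_zero hc (mul_ne_zero ht hs')))
  -- The factor is c times the fixed entry of the bare second wall, divided by that entry of the
  -- dressed one.
  refine ⟨_, div_ne_zero (mul_ne_zero hc hs') hF, fun i j k => ?_⟩
  ext s t
  rw [Matrix.smul_apply, smul_eq_mul, div_mul_eq_mul_div, eq_div_iff hF, key]
  ring

end Walls

/-! ### The relation between B and L -/

section Pentagon

variable {G : Type*} [Group G] {d : ℕ} {R : MPURep G d}
  {I : Type*} [MulAction G I] {S : GroundStates R I}

/-- The left endpoint that first fuses `g` and `h` and then lets `gh` act on `x`. -/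
def fuseThenActHat (F : FusionTensors R) (K : ActionTensors S) (g h : G) (x : I) :
    Matrix (Fin (S.D (g • h • x))) (Fin (R.χ g) × (Fin (R.χ h) × Fin (S.D x))) ℂ :=
  K.What (g * h) (mul_smul g h x)
    * (F.Vhat g h ⊗ₖ (1 : Matrix (Fin (S.D x)) (Fin (S.D x)) ℂ)).submatrix id
        (Equiv.prodAssoc (Fin (R.χ g)) (Fin (R.χ h)) (Fin (S.D x))).symm

/-- The left endpoint that first lets `h` act on `x` and then `g` act on `hx`. -/
def actThenActHat (K : ActionTensors S) (g h : G) (x : I) :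
    Matrix (Fin (S.D (g • h • x))) (Fin (R.χ g) × (Fin (R.χ h) × Fin (S.D x))) ℂ :=
  K.What g (rfl : g • h • x = g • h • x)
    * ((1 : Matrix (Fin (R.χ g)) (Fin (R.χ g)) ℂ) ⊗ₖ K.What h (rfl : h • x = h • x))

theorem ActionTensors.isSlidingReduction (K : ActionTensors S) (g : G) {x y : I}
    (hy : g • x = y) :
    IsSlidingReduction (applyMPO (R.T g) (S.A x)) (S.A y) (K.What g hy) (K.W g hy) :=
  (K.isReduction g hy).isSlidingReduction (S.injective y)

theorem isDeepReduction_fuseThenAct (F : FusionTensors R) (K : ActionTensors S) (g h : G)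
    (x : I) :
    IsDeepReduction (applyMPO (R.T g) (applyMPO (R.T h) (S.A x))) (S.A (g • h • x))
      (fuseThenActHat F K g h x) (fuseThenAct F K g h x) := by
  have e : applyMPO (R.T g) (applyMPO (R.T h) (S.A x)) = fun i =>
      (applyMPO (stackMPO (R.T g) (R.T h)) (S.A x) i).submatrix
        (Equiv.prodAssoc (Fin (R.χ g)) (Fin (R.χ h)) (Fin (S.D x))).symm
        (Equiv.prodAssoc (Fin (R.χ g)) (Fin (R.χ h)) (Fin (S.D x))).symm :=
    funext fun i => applyMPO_applyMPO _ _ _ i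
  rw [e]
  exact ((((F.isReduction g h).isSlidingReduction (R.injective _)).stack (S.A x)).reindex
    _).comp (K.isSlidingReduction _ _)

theorem isDeepReduction_actThenAct (K : ActionTensors S) (g h : G) (x : I) :
    IsDeepReduction (applyMPO (R.T g) (applyMPO (R.T h) (S.A x))) (S.A (g • h • x))
      (actThenActHat K g h x) (actThenAct K g h x) :=
  ((K.isSlidingReduction h rfl).applyMPO (R.T g)).comp (K.isSlidingReduction g rfl)

theorem GroundStates.nonempty (S : GroundStates R I) (x : I) : Nonempty (Fin (S.D x)) :=
  ⟨⟨0, S.D_pos x⟩⟩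

theorem exists_LSymbol (F : FusionTensors R) (K : ActionTensors S) (g h : G) (x : I) :
    ∃ r s : ℂ, s * r = 1 ∧
      (∀ i j, applyMPO (R.T g) (applyMPO (R.T h) (S.A x)) i
          * applyMPO (R.T g) (applyMPO (R.T h) (S.A x)) j * fuseThenAct F K g h x
        = r • (applyMPO (R.T g) (applyMPO (R.T h) (S.A x)) i
          * applyMPO (R.T g) (applyMPO (R.T h) (S.A x)) j * actThenAct K g h x)) ∧
      ∀ i j, fuseThenActHat F K g h x * applyMPO (R.T g) (applyMPO (R.T h) (S.A x)) i
          * applyMPO (R.T g) (applyMPO (R.T h) (S.A x)) j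
        = s • (actThenActHat K g h x * applyMPO (R.T g) (applyMPO (R.T h) (S.A x)) i
          * applyMPO (R.T g) (applyMPO (R.T h) (S.A x)) j) :=
  have := S.nonempty (g • h • x)
  (isDeepReduction_fuseThenAct F K g h x).exists_smul (isDeepReduction_actThenAct K g h x)
    (S.injective _)

theorem word_triple {ι n : Type*} [Fintype n] [DecidableEq n] (M : Tensor ι n) (i j k : ι) :
    word M [i, j, k] = M i * M j * M k := by
  simp [word, Matrix.mul_assoc]

theorem isLSymbol_of_forall (F : FusionTensors R) (K : ActionTensors S) {L : G → G → I → ℂ}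
    (hL : ∀ g h x i j, applyMPO (R.T g) (applyMPO (R.T h) (S.A x)) i
          * applyMPO (R.T g) (applyMPO (R.T h) (S.A x)) j * fuseThenAct F K g h x
        = L g h x • (applyMPO (R.T g) (applyMPO (R.T h) (S.A x)) i
          * applyMPO (R.T g) (applyMPO (R.T h) (S.A x)) j * actThenAct K g h x)) :
    IsLSymbol F K L := fun g h x i j k => by
  have := congrArg (applyMPO (R.T g) (applyMPO (R.T h) (S.A x)) i * ·) (hL g h x j k)
  simpa only [word_triple, Matrix.mul_smul, ← Matrix.mul_assoc] using this

theorem IsLSymbol.unique {F : FusionTensors R} {K : ActionTensors S} {L L' : G → G → I → ℂ}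
    (hL : IsLSymbol F K L) (hL' : IsLSymbol F K L') : L = L' := by
  funext g h x
  have := S.nonempty (g • h • x)
  obtain ⟨i, j, k, hne⟩ := (isDeepReduction_actThenAct K g h x).exists_ne_zero (S.injective _)
  refine smul_left_injective ℂ hne ?_
  simp only [← word_triple]
  rw [← hL, ← hL']

theorem IsWallFactor.unique {K : ActionTensors S} {E : WallTensors S} {B B' : G → I → I → ℂ}
    (hB : IsWallFactor K E B) (hB' : IsWallFactor K E B') : B = B' := by
  funext g x y
  obtain ⟨i, j, k, hne⟩ := exists_mul_mul_ne_zero (S.injective (g • x)) (S.injective (g • y))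
    (E.ne_zero (g • x) (g • y))
  refine smul_left_injective ℂ hne ?_
  simp only
  rw [← hB, ← hB']

theorem IsWallFactor.apply {K : ActionTensors S} {E : WallTensors S} {B : G → I → I → ℂ}
    (hB : IsWallFactor K E B) (g : G) {x y x' y' : I} (hx : g • x = x') (hy : g • y = y')
    (i j k : Fin d) :
    K.What g hx * applyMPO (R.T g) (S.A x) i * applyMPO (R.T g) (E.e x y) j
        * applyMPO (R.T g) (S.A y) k * K.W g hy
      = B g x y • (S.A x' i * E.e x' y' j * S.A y' k) := by
  subst hx hy
  exact hB g x y i j k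

/-- Each action tensor slides inwards past the outermost site. Two sites on either side of the wall
are what the exchange of composite endpoints requires. -/
theorem IsWallFactor.apply_five {K : ActionTensors S} {E : WallTensors S} {B : G → I → I → ℂ}
    (hB : IsWallFactor K E B) (g : G) {x y x' y' : I} (hx : g • x = x') (hy : g • y = y')
    (a i j k b : Fin d) :
    K.What g hx * applyMPO (R.T g) (S.A x) a * applyMPO (R.T g) (S.A x) i
        * applyMPO (R.T g) (E.e x y) j
        * applyMPO (R.T g) (S.A y) k * applyMPO (R.T g) (S.A y) b * K.W g hy
      = B g x y • (S.A x' a * S.A x' i * E.e x' y' j * S.A y' k * S.A y' b) := by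
  have e := congrArg (S.A x' a * K.What g hx * applyMPO (R.T g) (S.A x) i
    * applyMPO (R.T g) (E.e x y) j * ·) ((K.isSlidingReduction g hy).right k b)
  have e' := congrArg (S.A x' a * · * S.A y' b) (hB.apply g hx hy i j k)
  simp only [← Matrix.mul_assoc, Matrix.mul_smul, Matrix.smul_mul] at e e'
  rw [(K.isSlidingReduction g hx).left, e, e']

/-- The operator tensors of `g` and `h` on five sites around a wall. -/
def stackedWall (E : WallTensors S) (g h : G) (x y : I) (a i j k b : Fin d) :
    Matrix (Fin (R.χ g) × (Fin (R.χ h) × Fin (S.D x)))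
      (Fin (R.χ g) × (Fin (R.χ h) × Fin (S.D y))) ℂ :=
  applyMPO (R.T g) (applyMPO (R.T h) (S.A x)) a * applyMPO (R.T g) (applyMPO (R.T h) (S.A x)) i
    * applyMPO (R.T g) (applyMPO (R.T h) (E.e x y)) j
    * applyMPO (R.T g) (applyMPO (R.T h) (S.A y)) k
    * applyMPO (R.T g) (applyMPO (R.T h) (S.A y)) b

/-- The wall affects only the bottom layer: the operator layers form an ordinary word of T_g T_h,
which the fusion tensors reduce to T_{gh}. -/
theorem fuse_stackedWall (F : FusionTensors R) {K : ActionTensors S} {E : WallTensors S}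
    {B : G → I → I → ℂ} (hB : IsWallFactor K E B) (g h : G) (x y : I) (a i j k b : Fin d) :
    fuseThenActHat F K g h x * stackedWall E g h x y a i j k b * fuseThenAct F K g h y
      = B (g * h) x y • (S.A (g • h • x) a * S.A (g • h • x) i
        * E.e (g • h • x) (g • h • y) j * S.A (g • h • y) k * S.A (g • h • y) b) := by
  have hV : ∀ p q r s t, F.Vhat g h * (stackMPO (R.T g) (R.T h) p * stackMPO (R.T g) (R.T h) q
      * stackMPO (R.T g) (R.T h) r * stackMPO (R.T g) (R.T h) s * stackMPO (R.T g) (R.T h) t)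
      * F.V g h = R.T (g * h) p * R.T (g * h) q * R.T (g * h) r * R.T (g * h) s
        * R.T (g * h) t := fun p q r s t => by
    simpa [word, Matrix.mul_assoc] using (F.isReduction g h).reduce [p, q, r, s, t]
  have fuse : (F.Vhat g h ⊗ₖ (1 : Matrix (Fin (S.D x)) (Fin (S.D x)) ℂ)).submatrix id
        (Equiv.prodAssoc (Fin (R.χ g)) (Fin (R.χ h)) (Fin (S.D x))).symm
      * stackedWall E g h x y a i j k b
      * (F.V g h ⊗ₖ (1 : Matrix (Fin (S.D y)) (Fin (S.D y)) ℂ)).submatrix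
        (Equiv.prodAssoc (Fin (R.χ g)) (Fin (R.χ h)) (Fin (S.D y))).symm id
      = applyMPO (R.T (g * h)) (S.A x) a * applyMPO (R.T (g * h)) (S.A x) i
        * applyMPO (R.T (g * h)) (E.e x y) j
        * applyMPO (R.T (g * h)) (S.A y) k * applyMPO (R.T (g * h)) (S.A y) b := by
    simp only [stackedWall, applyMPO_applyMPO, Matrix.submatrix_mul_equiv,
      Matrix.submatrix_id_id]
    simp only [applyMPO_eq_contract, contract_mul_contract, kronecker_one_mul_contract,
      contract_mul_kronecker_one, hV]
  have := congrArg (K.What (g * h) (mul_smul g h x) * · * K.W (g * h) (mul_smul g h y)) fuse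
  simp only [← Matrix.mul_assoc] at this
  rw [hB.apply_five] at this
  simpa only [fuseThenActHat, fuseThenAct, ← Matrix.mul_assoc] using this

/-- The action tensors of h touch only the two lower layers and contribute B^h_{x,y}; what remains
is the wall between hx and hy under g. -/
theorem act_stackedWall {K : ActionTensors S} {E : WallTensors S}
    {B : G → I → I → ℂ} (hB : IsWallFactor K E B) (g h : G) (x y : I) (a i j k b : Fin d) :
    actThenActHat K g h x * stackedWall E g h x y a i j k b * actThenAct K g h y
      = (B g (h • x) (h • y) * B h x y) • (S.A (g • h • x) a * S.A (g • h • x) i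
        * E.e (g • h • x) (g • h • y) j * S.A (g • h • y) k * S.A (g • h • y) b) := by
  have inner : ((1 : Matrix (Fin (R.χ g)) (Fin (R.χ g)) ℂ) ⊗ₖ K.What h (rfl : h • x = h • x))
      * stackedWall E g h x y a i j k b
      * ((1 : Matrix (Fin (R.χ g)) (Fin (R.χ g)) ℂ) ⊗ₖ K.W h (rfl : h • y = h • y))
      = B h x y • (applyMPO (R.T g) (S.A (h • x)) a * applyMPO (R.T g) (S.A (h • x)) i
        * applyMPO (R.T g) (E.e (h • x) (h • y)) j
        * applyMPO (R.T g) (S.A (h • y)) k * applyMPO (R.T g) (S.A (h • y)) b) := by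
    simp only [stackedWall, applyMPO_eq_contract (R.T g), contract_mul_contract,
      one_kronecker_mul_contract, contract_mul_one_kronecker]
    rw [← contract_smul]
    congr 1
    funext p
    simpa only [← Matrix.mul_assoc] using hB.apply_five h rfl rfl _ _ _ _ _
  have := congrArg (K.What g (rfl : g • h • x = g • h • x) * ·
    * K.W g (rfl : g • h • y = g • h • y)) inner
  simp only [Matrix.mul_smul, Matrix.smul_mul, ← Matrix.mul_assoc] at this
  rw [hB.apply_five, smul_smul (B h x y)] at this
  rw [mul_comm (B g _ _)]
  simpa only [actThenActHat, actThenAct, ← Matrix.mul_assoc] using this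

end Pentagon

end DomainWalls

theorem mainTheorem3 {G : Type*} [Group G] [Finite G] {d : ℕ} (R : DomainWalls.MPURep G d)
    {I : Type*} [MulAction G I] [MulAction.IsPretransitive G I]
    (S : DomainWalls.GroundStates R I)
    (F : DomainWalls.FusionTensors R) (K : DomainWalls.ActionTensors S)
    (E : DomainWalls.WallTensors S) :
    (∃! L : G → G → I → ℂ, DomainWalls.IsLSymbol F K L) ∧
    (∃! B : G → I → I → ℂ, DomainWalls.IsWallFactor K E B) ∧
    ∀ (L : G → G → I → ℂ) (B : G → I → I → ℂ),
      DomainWalls.IsLSymbol F K L → DomainWalls.IsWallFactor K E B →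
      (∀ g h x, L g h x ≠ 0) ∧ (∀ g x y, B g x y ≠ 0) ∧
      ∀ (g h : G) (x y : I),
        B g (h • x) (h • y) * B h x y = L g h x / L g h y * B (g * h) x y := by
  choose L₀ M₀ hML hL₀ hM₀ using DomainWalls.exists_LSymbol F K
  choose B₀ hB₀ne hB₀ using DomainWalls.exists_wallFactor K E
  have hL := DomainWalls.isLSymbol_of_forall F K hL₀
  have hB : DomainWalls.IsWallFactor K E B₀ := hB₀
  have hL₀ne : ∀ g h x, L₀ g h x ≠ 0 := fun g h x =>
    right_ne_zero_of_mul ((hML g h x).trans_ne one_ne_zero)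
  refine ⟨⟨L₀, hL, fun L h => h.unique hL⟩, ⟨B₀, hB, fun B h => h.unique hB⟩, ?_⟩
  intro L B hL' hB'
  obtain rfl := hL'.unique hL
  obtain rfl := hB'.unique hB
  refine ⟨hL₀ne, hB₀ne, fun g h x y => ?_⟩
  -- `M₀` is the left endpoint scalar, inverse to L^x; the relation is read off from a nonzero
  -- five-site wall.
  have key : B (g * h) x y = M₀ g h x * L g h y * (B g (h • x) (h • y) * B h x y) := by
    obtain ⟨i, j, k, hne⟩ := DomainWalls.exists_mul_mul_ne_zero (S.injective (g • h • x))
      (S.injective (g • h • y)) (E.ne_zero (g • h • x) (g • h • y))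
    obtain ⟨a, b, hne⟩ : ∃ a b, S.A (g • h • x) a * S.A (g • h • x) i
        * E.e (g • h • x) (g • h • y) j * S.A (g • h • y) k * S.A (g • h • y) b ≠ 0 := by
      by_contra! h0
      refine hne ((S.injective (g • h • y)).mul_right_cancel fun b =>
        (S.injective (g • h • x)).mul_left_cancel fun a => ?_)
      simpa [Matrix.mul_assoc] using h0 a b
    refine smul_left_injective ℂ hne ?_
    simp only
    rw [← DomainWalls.fuse_stackedWall F hB', mul_smul, ← DomainWalls.act_stackedWall hB']
    have e1 := hM₀ g h x a i
    have e2 := hL₀ g h y k b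
    generalize DomainWalls.fuseThenActHat F K g h x = Pf at *
    generalize DomainWalls.fuseThenAct F K g h y = Qf at *
    simp only [DomainWalls.stackedWall, ← Matrix.mul_assoc]
    rw [e1]
    simp only [Matrix.mul_assoc, Matrix.smul_mul] at e2 ⊢
    rw [e2]
    simp only [Matrix.mul_smul, smul_smul]
  rw [key, div_mul_eq_mul_div, eq_div_iff (hL₀ne g h y)]
  linear_combination (-(L g h y * (B g (h • x) (h • y) * B h x y))) * hML g h x
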